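/- **Setting.** Let $p$ be a prime and let $(S,\mathcal F,\mathcal L)$ be a $p$-local finite group: $S$ is a finite $p$-group, $\mathcal F$ is a saturated fusion system over $S$, and $\mathcal L$ is a centric linking system associated to $\mathcal F$, i.e. a finite category whose objects are the $\mathcal F$-centric subgroups of $S$, with functors $\delta:\mathcal T_S^c\to\mathcal L$ (where $\mathcal T^c_S(P,Q)=\{g\in S\mid gPg^{-1}\le Q\}$) and $\pi:\mathcal L\to\mathcal F^c$, both the identity on objects, such that: $C_S(P)$ acts freely on $\mathrm{Mor}_{\mathcal L}(P,Q)$ by precomposition with $\delta(g)$ and $\pi$ induces a bijection from the set of orbits onto $\mathrm{Hom}_{\mathcal F}(P,Q)$; $\pi(\delta(g))=c_g$ (where $c_g(x)=gxg^{-1}$); and $\psi\circ\delta(g)=\delta(\pi(\psi)(g))\circ\psi$ for $\psi\in\mathrm{Mor}_{\mathcal L}(P,Q)$, $g\in P$. Here $\mathcal F^c\subseteq\mathcal F$ is the full subcategory on the $\mathcal F$-centric subgroups. Let $|\mathcal L|$ be the geometric realization of the nerve of $\mathcal L$ and $\pi_{\mathcal L}=\pi_1(|\mathcal L|,S)$.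 Put $\iota_P=\delta(1)\in\mathrm{Mor}_{\mathcal L}(P,S)$. For $\psi\in\mathrm{Mor}_{\mathcal L}(P,Q)$ let $\omega(\psi)\in\pi_{\mathcal L}$ be the class of the loop that runs along the edge $\iota_P$ backwards, then along $\psi$, then along $\iota_Q$; products in $\pi_{\mathcal L}$ are written like compositions, so that $\omega(\psi\circ\psi')=\omega(\psi)\omega(\psi')$. Let $M$ be a $\mathbb Z_{(p)}[\pi_{\mathcal L}]$-module. Then $S$, and each $P\le S$, acts on $M$ through $s\mapsto\omega(\delta(s))$, and $H^*(P,M)$ denotes group cohomology. For $\psi\in\mathrm{Mor}_{\mathcal L}(Q,Q')$ and $P_0\le Q$, $P_1\le Q'$ with $\pi(\psi)(P_0)\le P_1$, the pair $(\pi(\psi)|_{P_0}^{P_1},\omega(\psi)^{-1})$ induces a map $H^*(\pi(\psi)|_{P_0}^{P_1},\omega(\psi)^{-1}):H^*(P_1,M)\to H^*(P_0,M)$. For $\varphi\in\mathrm{Hom}_{\mathcal F}(P,Q)$ with $P,Q$ $\mathcal F$-centric, let $\varphi^*:H^*(Q,M)\to H^*(P,M)$ be $H^*(\varphi,\omega(\psi)^{-1})$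 for any $\psi\in\mathrm{Mor}_{\mathcal L}(P,Q)$ with $\pi(\psi)=\varphi$ (it does not depend on the choice of $\psi$). The submodule of $\mathcal F^c$-stable elements is $$H^*(\mathcal F^c,M)=\{x\in H^*(S,M)\mid \varphi^*(x)=\mathrm{Res}^S_P(x)\text{ for all }\mathcal F\text{-centric }P\le S\text{ and all }\varphi\in\mathrm{Hom}_{\mathcal F}(P,S)\}.$$ **Bisets.** For $P\le S$ and a homomorphism $\varphi:P\to S$ let $[P,\varphi]=(S\times S)/\{(x,\varphi(x))\mid x\in P\}$, an $(S,S)$-biset. A left-free $(S,S)$-biset $\Omega$ is *$\mathcal F$-characteristic* if it is a finite disjoint union of bisets isomorphic to some $[P,\varphi]$ with $P\le S$ and $\varphi\in\mathrm{Hom}_{\mathcal F}(P,S)$; if ${}_\varphi\Omega_S\cong{}_P\Omega_S$ and ${}_S\Omega_\varphi\cong{}_S\Omega_P$ for all $P\le S$ and $\varphi\in\mathrm{Hom}_{\mathcal F}(P,S)$; and if $|\Omega|/|S|\not\equiv0\pmod p$. **$\Omega$-endomorphisms.** Let $P\le S$ and $\varphi\in\mathrm{Hom}_{\mathcal F}(P,S)$.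 A *$[P,\varphi]$-endomorphism* of $H^*(S,M)$ is a composite $$\mathrm{tr}_P^S\circ H^*(\pi(\psi_1)|_{P_0}^{P_1},\omega(\psi_1)^{-1})\circ\cdots\circ H^*(\pi(\psi_r)|_{P_{r-1}}^{P_r},\omega(\psi_r)^{-1})\circ\mathrm{Res}^S_{\varphi(P)},$$ where $r\ge0$, $P_0=P$, $\psi_i\in\mathrm{Aut}_{\mathcal L}(Q_i)$ for $\mathcal F$-centric subgroups $Q_i\ge P_{i-1}$, $P_i=\pi(\psi_i)(P_{i-1})$, $P_r=\varphi(P)$, and $\varphi=\mathrm{incl}_{\varphi(P)}^S\circ\pi(\psi_r)|_{P_{r-1}}^{P_r}\circ\cdots\circ\pi(\psi_1)|_{P_0}^{P_1}$. For an $\mathcal F$-characteristic biset $\Omega\cong\coprod_i[P_i,\varphi_i]$ with $\varphi_i\in\mathrm{Hom}_{\mathcal F}(P_i,S)$, an *$\Omega$-endomorphism* is a sum $\sum_i\lambda_i$ in which $\lambda_i$ is a $[P_i,\varphi_i]$-endomorphism. **Lemma.** Let $M$ be any $\mathbb Z_{(p)}[\pi_{\mathcal L}]$-module, $\Omega$ an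 $\mathcal F$-characteristic $(S,S)$-biset and $\omega_*$ an $\Omega$-endomorphism of $H^*(S,M)$. Then the endomorphism $\frac{|S|}{|\Omega|}\omega_*$ of $H^*(S,M)$ restricts to the identity on $H^*(\mathcal F^c,M)$: for every $n\ge0$ and every $x\in H^n(\mathcal F^c,M)$, $\frac{|S|}{|\Omega|}\,\omega_*(x)=x$. -/

import Mathlib

open CategoryTheory
universe u
noncomputable section

namespace NerveRealization
open Opposite Simplicial

variable {C : Type u} [SmallCategory C]

/-- The geometric realization `|C|` of (the nerve of) a small category. -/
abbrev Realization (C : Type u) [SmallCategory C] : TopCat.{u} := SSet.toTop.obj (nerve C)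

/-- The characteristic map of an `n`-simplex of the nerve. -/
def charMap {n : ℕ} (x : ComposableArrows C n) : C(stdSimplex ℝ (Fin (n + 1)), Realization C) :=
  TopCat.toSSetObjEquiv _ (op ⦋n⦌) ((sSetTopAdj.unit.app (nerve C)).app (op ⦋n⦌) x)

lemma charMap_δ {n : ℕ} (x : ComposableArrows C (n + 1)) (i : Fin (n + 2))
    (z : stdSimplex ℝ (Fin (n + 1))) :
    charMap ((nerve C).δ i x : ComposableArrows C n) z
      = charMap x (stdSimplex.map i.succAbove z) := by
  have h := ConcreteCategory.congr_hom
    ((sSetTopAdj.unit.app (nerve C)).naturality (SimplexCategory.δ i).op) x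
  unfold charMap
  refine Eq.trans (congrArg (fun y => TopCat.toSSetObjEquiv _ (op ⦋n⦌) y z) h) ?_
  rfl

/-- The vertex of `|C|` given by an object. -/
def vertex (X : C) : Realization C := charMap (ComposableArrows.mk₀ X) default

lemma charMap_mk₁_zero {X Y : C} (f : X ⟶ Y) :
    charMap (ComposableArrows.mk₁ f) (stdSimplexHomeomorphUnitInterval.symm 0) = vertex X := by
  have h := charMap_δ (ComposableArrows.mk₁ f) 1 default
  have e : ((nerve C).δ 1 (ComposableArrows.mk₁ f) : ComposableArrows C 0)
      = ComposableArrows.mk₀ X := ComposableArrows.ext₀ rfl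
  rw [e] at h
  rw [vertex, h]
  congr 1
  rw [Homeomorph.symm_apply_eq]
  rw [Subsingleton.elim (default : stdSimplex ℝ (Fin 1)) (stdSimplex.vertex 0),
    stdSimplex.map_vertex]
  rfl

lemma charMap_mk₁_one {X Y : C} (f : X ⟶ Y) :
    charMap (ComposableArrows.mk₁ f) (stdSimplexHomeomorphUnitInterval.symm 1) = vertex Y := by
  have h := charMap_δ (ComposableArrows.mk₁ f) 0 default
  have e : ((nerve C).δ 0 (ComposableArrows.mk₁ f) : ComposableArrows C 0)
      = ComposableArrows.mk₀ Y := ComposableArrows.ext₀ rfl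
  rw [e] at h
  rw [vertex, h]
  congr 1
  rw [Homeomorph.symm_apply_eq]
  rw [Subsingleton.elim (default : stdSimplex ℝ (Fin 1)) (stdSimplex.vertex 0),
    stdSimplex.map_vertex]
  rfl

/-- The edge of `|C|` given by a morphism, as a path. -/
def edgePath {X Y : C} (f : X ⟶ Y) : Path (vertex X) (vertex Y) where
  toFun t := charMap (ComposableArrows.mk₁ f) (stdSimplexHomeomorphUnitInterval.symm t)
  continuous_toFun := by fun_prop
  source' := charMap_mk₁_zero f
  target' := charMap_mk₁_one f

/-- The homotopy class of the edge, as a morphism of the fundamental groupoid. -/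
def edge {X Y : C} (f : X ⟶ Y) :
    FundamentalGroupoid.mk (vertex X) ⟶ FundamentalGroupoid.mk (vertex Y) :=
  Path.Homotopic.Quotient.mk (edgePath f)

instance (n : ℕ) : SimplyConnectedSpace (stdSimplex ℝ (Fin (n + 1))) := by
  have : ContractibleSpace (stdSimplex ℝ (Fin (n + 1))) :=
    (convex_stdSimplex ℝ (Fin (n+1))).contractibleSpace
      ⟨_, (stdSimplex.vertex (S := ℝ) (0 : Fin (n + 1))).2⟩
  infer_instance

/-- a face path in the standard triangle -/
def facePath (i j : Fin 3) (k : Fin 3) (h0 : k.succAbove 0 = i) (h1 : k.succAbove 1 = j) :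
    Path (stdSimplex.vertex (S := ℝ) i) (stdSimplex.vertex (S := ℝ) j) where
  toFun t := stdSimplex.map k.succAbove (stdSimplexHomeomorphUnitInterval.symm t)
  continuous_toFun := (stdSimplex.continuous_map _).comp (Homeomorph.continuous _)
  source' := by
    have : stdSimplexHomeomorphUnitInterval.symm 0 = stdSimplex.vertex (S := ℝ) 0 := by
      rw [Homeomorph.symm_apply_eq]; rfl
    rw [this, stdSimplex.map_vertex, h0]
  target' := by
    have : stdSimplexHomeomorphUnitInterval.symm 1 = stdSimplex.vertex (S := ℝ) 1 := by
      rw [Homeomorph.symm_apply_eq]; rfl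
    rw [this, stdSimplex.map_vertex, h1]

lemma edge_comp {X Y Z : C} (f : X ⟶ Y) (g : Y ⟶ Z) : edge (f ≫ g) = edge f ≫ edge g := by
  let σ := charMap (ComposableArrows.mk₂ f g)
  have hom : (facePath 0 2 1 rfl rfl).Homotopic
      ((facePath 0 1 2 rfl rfl).trans (facePath 1 2 0 rfl rfl)) :=
    SimplyConnectedSpace.paths_homotopic _ _
  have key := hom.map σ
  rw [Path.map_trans] at key
  have e1 : ∀ t, (facePath 0 2 1 rfl rfl).map σ.continuous t = edgePath (f ≫ g) t := fun t => by
    have := charMap_δ (ComposableArrows.mk₂ f g) 1 (stdSimplexHomeomorphUnitInterval.symm t)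
    rw [nerve.δ₁_mk₂_eq] at this
    exact this.symm
  have e2 : ∀ t, (facePath 0 1 2 rfl rfl).map σ.continuous t = edgePath f t := fun t => by
    have := charMap_δ (ComposableArrows.mk₂ f g) 2 (stdSimplexHomeomorphUnitInterval.symm t)
    rw [nerve.δ₂_mk₂_eq] at this
    exact this.symm
  have e3 : ∀ t, (facePath 1 2 0 rfl rfl).map σ.continuous t = edgePath g t := fun t => by
    have := charMap_δ (ComposableArrows.mk₂ f g) 0 (stdSimplexHomeomorphUnitInterval.symm t)
    rw [nerve.δ₀_mk₂_eq] at this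
    exact this.symm
  have h0 : σ (stdSimplex.vertex 0) = vertex X := by
    simpa using e2 0
  have h1 : σ (stdSimplex.vertex 1) = vertex Y := by
    simpa using e2 1
  have h2 : σ (stdSimplex.vertex 2) = vertex Z := by
    simpa using e3 1
  have f1 : edgePath (f ≫ g) = ((facePath 0 2 1 rfl rfl).map σ.continuous).cast h0.symm h2.symm := by
    ext t; exact (e1 t).symm
  have f2 : edgePath f = ((facePath 0 1 2 rfl rfl).map σ.continuous).cast h0.symm h1.symm := by
    ext t; exact (e2 t).symm
  have f3 : edgePath g = ((facePath 1 2 0 rfl rfl).map σ.continuous).cast h1.symm h2.symm := by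
    ext t; exact (e3 t).symm
  change Path.Homotopic.Quotient.mk _ = Path.Homotopic.Quotient.trans (.mk _) (.mk _)
  rw [← Path.Homotopic.Quotient.mk_trans, Path.Homotopic.Quotient.eq, f1, f2, f3]
  exact key.pathCast h0.symm h2.symm

lemma edge_id (X : C) : edge (𝟙 X) = 𝟙 _ := by
  have h := edge_comp (𝟙 X) (𝟙 X)
  rw [Category.comp_id] at h
  have := congrArg (fun q => Groupoid.inv (edge (𝟙 X)) ≫ q) h
  simpa using this.symm

end NerveRealization
namespace GroupTransfer
open Rep groupCohomology

variable {k G : Type u} [CommRing k] [Group G] (P : Subgroup G)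

/-- The map of bar resolutions induced by the inclusion of a subgroup. -/
def barMapX (n : ℕ) :
    free k P (Fin n → P) ⟶ res P.subtype (free k G (Fin n → G)) :=
  freeLift k P _ fun x => (Finsupp.single (fun i => (x i : G)) (.single 1 1) :
    (Fin n → G) →₀ MonoidAlgebra k G)

lemma barMapX_single (n : ℕ) (x : Fin n → P) (g : P) (r : k) :
    (barMapX (k := k) P n).hom (Finsupp.single x (.single g r)) =
      (Finsupp.single (fun i => (x i : G)) (.single (g : G) r) :
        (Fin n → G) →₀ MonoidAlgebra k G) := by
  unfold barMapX
  rw [Rep.hom_ofHom, Representation.freeLift_single_single]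
  change r • (Representation.free k G (Fin n → G)) (g : G) _ = _
  simp

/-- The bar resolution of `G`, as a projective resolution over the subgroup `P`. -/
def resBar : ProjectiveResolution (Rep.trivial k P k) :=
  (resFunctor (k := k) P.subtype).mapProjectiveResolution (barResolution k G)

lemma d_free (n : ℕ) : (resBar (k := k) P).complex.d (n+1) n =
    resMap P.subtype (barComplex.d k G n) :=
  congrArg (resMap P.subtype) (barComplex.d_def k G)

def barMap : barComplex k P ⟶ (resBar (k := k) P).complex where
  f n := barMapX P n
  comm' i j hij := by
    obtain rfl : j + 1 = i := hij
    rw [barComplex.d_def, d_free]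
    refine free_ext k P _ _ _ fun x => ?_
    change (barComplex.d k G j).hom ((barMapX (k := k) P (j+1)).hom _) =
      (barMapX (k := k) P j).hom ((barComplex.d k P j).hom _)
    rw [barMapX_single, barComplex.d_single, map_add, map_sum, barMapX_single]
    refine Eq.trans (barComplex.d_single (k := k) (G := G) (n := j) (fun i => (x i : G))) ?_
    congr 1
    refine Finset.sum_congr rfl fun a _ => ?_
    rw [barMapX_single]
    congr 1
    have := Fin.comp_contractNth (fun a b : P => a * b) (fun a b : G => a * b)
      (f := (Subtype.val : P → G)) (fun _ _ => rfl) a x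
    exact this.symm

lemma diag_inv (k G : Type u) [CommRing k] [Group G] (m : ℕ) (f : Fin m → G) (g : G) (r : k) :
    ∃ h : Fin (m + 1) → G,
      (diagonalSuccIsoFree k G m).inv.hom (Finsupp.single f (MonoidAlgebra.single g r)) =
      (MonoidAlgebra.single h r : MonoidAlgebra k (Fin (m + 1) → G)) := by
  simp only [diagonalSuccIsoFree, diagonalSuccIsoTensorTrivial, Iso.trans_inv, Rep.hom_comp,
    Representation.IntertwiningMap.comp_apply]
  have step1 : (Hom.hom (leftRegularTensorTrivialIsoFree k G (Fin m → G)).inv)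
      (Finsupp.single f (.single g r)) = TensorProduct.tmul k (.single g 1) (.single f r) :=
    Representation.leftRegularTensorTrivialIsoFree_symm_apply_single_single f g r
  rw [step1]
  have key₁ := Representation.linearizeMap_single (k := k)
    (Action.diagonalSuccIsoTensorTrivial G m).inv (g, f) ((1 : k) * r)
  have key₂ := Representation.LinearizeMonoidal.μ_apply_single_single (k := k)
    (X := Action.leftRegular G) (Y := Action.trivial G (Fin m → G)) g f 1 r
  refine ⟨(ConcreteCategory.hom (Action.diagonalSuccIsoTensorTrivial G m).inv.hom) (g, f),
    ((congrArg (fun z => (Representation.linearizeMap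
    (Action.diagonalSuccIsoTensorTrivial G m).inv) z) key₂).trans key₁).trans ?_⟩
  rw [one_mul]

lemma barResolution_π_zero (k G : Type u) [CommRing k] [Group G] (x : Fin 0 → G) (g : G) :
    Rep.Hom.hom (A := free k G (Fin 0 → G)) (B := Rep.trivial k G k)
      ((barResolution k G).π.f 0) (Finsupp.single x (.single g 1)) = (1 : k) := by
  have e : (barResolution k G).π.f 0 =
      (diagonalSuccIsoFree k G 0).inv ≫ standardComplex.ε k G := by
    change (diagonalSuccIsoFree k G 0).inv ≫ (standardComplex.εToSingle₀ k G).f 0 = _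
    rfl
  refine (congrArg (fun q : free k G (Fin 0 → G) ⟶ Rep.trivial k G k =>
    q.hom (Finsupp.single x (.single g 1))) e).trans ?_
  change (standardComplex.ε k G).hom ((diagonalSuccIsoFree k G 0).inv.hom _) = _
  obtain ⟨h, hh⟩ := diag_inv k G 0 x g 1
  rw [hh]
  change (Finsupp.linearCombination k fun _ ↦ (1 : k)) (MonoidAlgebra.coeffLinearEquiv k _) = _
  simp

lemma resBar_π_zero : (resBar (k := k) P).π.f 0 =
    resMap P.subtype ((barResolution k G).π.f 0) := by
  unfold resBar
  rw [Functor.mapProjectiveResolution_π]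
  refine Eq.trans ?_ (Category.comp_id _)
  rw [HomologicalComplex.comp_f]
  congr 1

lemma barMap_π_zero : (barMap (k := k) P ≫ (resBar P).π).f 0 =
    barMapX P 0 ≫ resMap P.subtype ((barResolution k G).π.f 0) := by
  exact congrArg (fun q : res P.subtype (free k G (Fin 0 → G)) ⟶ Rep.trivial k P k =>
    barMapX P 0 ≫ q) (resBar_π_zero P)

lemma barMap_π : barMap (k := k) P ≫ (resBar P).π = (barResolution k P).π := by
  apply HomologicalComplex.to_single_hom_ext
  rw [barMap_π_zero]
  refine free_ext k P _ _ _ fun x => ?_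
  refine Eq.trans ?_ (barResolution_π_zero k P x 1).symm
  refine Eq.trans ?_ (barResolution_π_zero k G (fun i => x i) 1)
  exact congrArg (Rep.Hom.hom (A := free k G (Fin 0 → G)) (B := Rep.trivial k G k)
      ((barResolution k G).π.f 0)) (barMapX_single P 0 x 1 1)

/-- The map of bar resolutions is a homotopy equivalence. -/
def barEquiv : HomotopyEquiv (barComplex k P) (resBar (k := k) P).complex where
  hom := barMap P
  inv := ProjectiveResolution.lift (𝟙 _) (resBar P) (barResolution k P)
  homotopyHomInvId := ProjectiveResolution.liftHomotopy (P := barResolution k P)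
    (Q := barResolution k P) (𝟙 _) _ _ (by
      rw [CategoryTheory.Functor.map_id, Category.comp_id]
      refine (Category.assoc _ _ _).trans ?_
      refine (congrArg (fun q => barMap P ≫ q) (ProjectiveResolution.lift_commutes (𝟙 _)
        (resBar P) (barResolution k P))).trans ?_
      rw [CategoryTheory.Functor.map_id, Category.comp_id]
      exact barMap_π P) (by
      rw [CategoryTheory.Functor.map_id, Category.comp_id]
      exact Category.id_comp _)
  homotopyInvHomId := ProjectiveResolution.liftHomotopy (P := resBar P) (Q := resBar P) (𝟙 _) _ _
    (by
      rw [CategoryTheory.Functor.map_id, Category.comp_id]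
      refine (Category.assoc _ _ _).trans ?_
      rw [barMap_π]
      refine (ProjectiveResolution.lift_commutes (𝟙 _)
        (resBar P) (barResolution k P)).trans ?_
      rw [CategoryTheory.Functor.map_id, Category.comp_id]) (by
      rw [CategoryTheory.Functor.map_id, Category.comp_id]
      exact Category.id_comp _)

variable (A : Rep.{u} k P)

/-- Evaluation at `1`, as a `P`-equivariant map from the coinduced module. -/
def evOne : res P.subtype (coind P.subtype A) ⟶ A :=
  Rep.ofHom ⟨LinearMap.proj 1 ∘ₗ (A.ρ.coindV P.subtype).subtype, fun g => by
    ext x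
    change x.1 (1 * (g : G)) = A.ρ g (x.1 1)
    rw [one_mul]
    have := x.2 g 1
    simpa using this⟩

/-- The Shapiro map `H^n(G, Coind A) ⟶ H^n(P, A)`: restriction followed by evaluation at `1`. -/
def shapiro (n : ℕ) : groupCohomology (coind P.subtype A) n ⟶ groupCohomology A n :=
  groupCohomology.map P.subtype (evOne P A) n

/-- The map induced by `barMap` on complexes of equivariant maps. -/
def barMapDual :
    (resBar P).complex.linearYonedaObj k A ⟶ (barComplex k P).linearYonedaObj k A :=
  (HomologicalComplex.unopFunctor _ _).map
    (((((linearYoneda k (Rep k P)).obj A).rightOp.mapHomologicalComplex _).map (barMap P)).op)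

instance : QuasiIso (barMapDual P A) := by
  have h : QuasiIso (((((linearYoneda k (Rep k P)).obj A).rightOp.mapHomologicalComplex _).map
      (barMap P))) :=
    inferInstanceAs (QuasiIso (((((linearYoneda k (Rep k P)).obj A).rightOp.mapHomotopyEquiv
      (barEquiv P))).hom))
  exact (HomologicalComplex.quasiIso_unopFunctor_map_iff _).2 h

/-- Equivariant maps from the bar resolution into the coinduced module. -/
def dualIso : inhomogeneousCochains (coind P.subtype A) ≅ (resBar P).complex.linearYonedaObj k A :=
  inhomogeneousCochainsIso (coind P.subtype A) ≪≫
    (linearYonedaObjResProjectiveResolutionIso (barResolution k G) A).symm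

lemma cochainsMap_eq : cochainsMap P.subtype (evOne P A) =
    (dualIso P A).hom ≫ (barMapDual P A ≫ (inhomogeneousCochainsIso A).inv) := by
  refine HomologicalComplex.hom_ext _ _ fun n => ModuleCat.hom_ext (LinearMap.ext fun f =>
    funext fun x => ?_)
  change (f (fun i => (x i : G))).1 1 = ((freeLift k G (coind P.subtype A) f).hom
    ((barMapX (k := k) P n).hom (Finsupp.single x (.single 1 1)))).1 1
  rw [barMapX_single, Rep.hom_ofHom, Representation.freeLift_single_single, Subgroup.coe_one,
    map_one, one_smul]
  rfl

instance (n : ℕ) : IsIso (shapiro P A n) := by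
  have : QuasiIso (cochainsMap P.subtype (evOne P A)) := by
    rw [cochainsMap_eq]
    infer_instance
  have := this.1 n
  exact (quasiIsoAt_iff_isIso_homologyMap _ _).1 this

variable (M : Rep.{u} k G)

/-- The map `f ↦ g f(g⁻¹)` from the coinduced module of `M` to `M`. -/
def normTerm (g : G) : coind P.subtype (res P.subtype M) →ₗ[k] M :=
  M.ρ g ∘ₗ LinearMap.proj g⁻¹ ∘ₗ ((res P.subtype M).ρ.coindV P.subtype).subtype

lemma normTerm_mul (g : G) (p : P) : normTerm P M (g * p) = normTerm P M g := by
  ext f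
  change M.ρ (g * p) (f.1 (g * p)⁻¹) = M.ρ g (f.1 g⁻¹)
  have h : f.1 ((p⁻¹ : P) * g⁻¹) = M.ρ (p⁻¹ : P) (f.1 g⁻¹) := f.2 p⁻¹ g⁻¹
  rw [mul_inv_rev, ← Subgroup.coe_inv, h, ← Module.End.mul_apply, ← map_mul]
  simp

/-- The map `f ↦ g f(g⁻¹)` only depends on the coset `g P`. -/
def normTermQuot (q : G ⧸ P) : coind P.subtype (res P.subtype M) →ₗ[k] M :=
  Quotient.liftOn' q (normTerm P M) fun a b h => by
    have := normTerm_mul P M a ⟨a⁻¹ * b, QuotientGroup.leftRel_apply.1 h⟩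
    simpa using this.symm

lemma normTermQuot_smul (h : G) (q : G ⧸ P) :
    normTermQuot P M (h • q) ∘ₗ (coind P.subtype (res P.subtype M)).ρ h =
      M.ρ h ∘ₗ normTermQuot P M q := by
  induction q using QuotientGroup.induction_on with | H g => ?_
  ext f
  change M.ρ (h * g) (f.1 ((h * g)⁻¹ * h)) = M.ρ h (M.ρ g (f.1 g⁻¹))
  rw [← Module.End.mul_apply, ← map_mul]
  simp

/-- The norm map `Coind M → M`, `f ↦ ∑_{g ∈ G/P} g f(g⁻¹)`, for a `G`-module `M`. -/
def normMap [Finite G] : coind P.subtype (res P.subtype M) ⟶ M :=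
  letI := Fintype.ofFinite (G ⧸ P)
  Rep.ofHom ⟨∑ q : G ⧸ P, normTermQuot P M q, fun h => by
    refine LinearMap.ext fun f => ?_
    change (∑ q : G ⧸ P, normTermQuot P M q) ((coind P.subtype (res P.subtype M)).ρ h f) =
      M.ρ h ((∑ q : G ⧸ P, normTermQuot P M q) f)
    rw [LinearMap.sum_apply, LinearMap.sum_apply, map_sum, ← Equiv.sum_comp (MulAction.toPerm h)]
    exact Finset.sum_congr rfl fun q _ => LinearMap.congr_fun (normTermQuot_smul P M h q) f⟩

/-- The transfer `H^n(P, M) ⟶ H^n(G, M)`: the inverse of the Shapiro isomorphism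
`H^n(G, Coind M) ⟶ H^n(P, M)`, followed by the norm map `Coind M → M` on coefficients. -/
def transfer [Finite G] (n : ℕ) :
    groupCohomology (res P.subtype M) n ⟶ groupCohomology M n :=
  inv (shapiro P (res P.subtype M) n) ≫ groupCohomology.map (MonoidHom.id G) (normMap P M) n

end GroupTransfer

/-! ### Fusion systems -/

section

variable {S : Type u} [Group S]

/-- The conjugation homomorphism `c_g : P → Q`, `x ↦ g x g⁻¹`, when `g P g⁻¹ ≤ Q`. -/
def conjHom (g : S) (P Q : Subgroup S) (h : ∀ x ∈ P, g * x * g⁻¹ ∈ Q) : P →* Q :=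
  ((MulAut.conj g).toMonoidHom.comp P.subtype).codRestrict Q fun x => h x x.2

/-- A fusion system over `S`: a category whose objects are the subgroups of `S`, whose morphisms
are injective group homomorphisms (composed as such) and include those induced by conjugation in
`S`, and in which every morphism is an isomorphism followed by an inclusion. -/
structure FusionSystem (S : Type u) [Group S] where
  Hom (P Q : Subgroup S) : Set (P →* Q)
  conj_mem (P Q : Subgroup S) (g : S) (h : ∀ x ∈ P, g * x * g⁻¹ ∈ Q) : conjHom g P Q h ∈ Hom P Q
  injective {P Q : Subgroup S} (φ : P →* Q) (hφ : φ ∈ Hom P Q) : Function.Injective φ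
  comp_mem {P Q R : Subgroup S} (φ : P →* Q) (ψ : Q →* R) (hφ : φ ∈ Hom P Q) (hψ : ψ ∈ Hom Q R) :
    ψ.comp φ ∈ Hom P R
  exists_iso {P Q : Subgroup S} (φ : P →* Q) (hφ : φ ∈ Hom P Q) :
    ∃ (R : Subgroup S) (hR : R ≤ Q) (e : P ≃* R), e.toMonoidHom ∈ Hom P R ∧
      e.symm.toMonoidHom ∈ Hom R P ∧ φ = (Subgroup.inclusion hR).comp e.toMonoidHom

namespace FusionSystem

variable (F : FusionSystem S)

/-- `φ ∈ Hom_F(P, S)`, for `φ` a homomorphism from `P` to the group `S` itself. -/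
def HomS (P : Subgroup S) : Set (P →* S) :=
  {φ | ∃ φ' ∈ F.Hom P ⊤, φ = (⊤ : Subgroup S).subtype.comp φ'}

/-- `e : P → Q` is an isomorphism in the category `F`. -/
def IsIso {P Q : Subgroup S} (e : P ≃* Q) : Prop :=
  e.toMonoidHom ∈ F.Hom P Q ∧ e.symm.toMonoidHom ∈ F.Hom Q P

/-- `P` and `Q` are `F`-conjugate. -/
def IsConj (P Q : Subgroup S) : Prop := ∃ e : P ≃* Q, F.IsIso e

/-- `P` is fully centralized in `F`. -/
def IsFullyCentralized (P : Subgroup S) : Prop :=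
  ∀ Q, F.IsConj P Q →
    Nat.card (Subgroup.centralizer (Q : Set S)) ≤ Nat.card (Subgroup.centralizer (P : Set S))

/-- `P` is `F`-centric: `C_S(Q) = Z(Q)` for every `Q` which is `F`-conjugate to `P`. -/
def IsCentric (P : Subgroup S) : Prop :=
  ∀ Q, F.IsConj P Q →
    Subgroup.centralizer (Q : Set S) = (Subgroup.center Q).map Q.subtype

lemma id_mem (P : Subgroup S) : MonoidHom.id P ∈ F.Hom P P := by
  have h := F.conj_mem P P 1 (by simp)
  convert h
  ext x
  simp [conjHom]

lemma inclusion_mem {P Q : Subgroup S} (h : P ≤ Q) : Subgroup.inclusion h ∈ F.Hom P Q := by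
  have h := F.conj_mem P Q 1 (by simpa using fun x hx => h hx)
  convert h
  ext x
  simp [conjHom]

/-- The automorphism group `Aut_F(P)`. -/
def autF (P : Subgroup S) : Subgroup (MulAut P) where
  carrier := {α | α.toMonoidHom ∈ F.Hom P P}
  mul_mem' {a b} ha hb := F.comp_mem _ _ hb ha
  one_mem' := F.id_mem P
  inv_mem' {a} ha := by
    obtain ⟨R, hR, e, -, he', h⟩ := F.exists_iso _ ha
    have hx : ∀ x : P, (a x : S) = e x := fun x =>
      congrArg Subtype.val (DFunLike.congr_fun h x)
    have hPR : P ≤ R := fun x hx' => by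
      have := hx (a.symm ⟨x, hx'⟩)
      rw [MulEquiv.apply_symm_apply] at this
      simp only at this
      rw [this]; exact (e _).2
    have := F.comp_mem _ _ (F.inclusion_mem hPR) he'
    change (a⁻¹ : MulAut P).toMonoidHom ∈ F.Hom P P
    have e2 : (a⁻¹ : MulAut P).toMonoidHom =
        e.symm.toMonoidHom.comp (Subgroup.inclusion hPR) := by
      refine MonoidHom.ext fun x => ?_
      change a.symm x = e.symm (Subgroup.inclusion hPR x)
      rw [MulEquiv.eq_symm_apply]
      apply Subtype.ext
      rw [← hx, MulEquiv.apply_symm_apply]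
      rfl
    rw [e2]
    exact this

/-- The group `Aut_S(P)` of automorphisms of `P` induced by conjugation in `S`. -/
def autS (P : Subgroup S) : Subgroup (MulAut P) := P.normalizerMonoidHom.range

/-- `P` is fully automized: `Aut_S(P)` is a Sylow `p`-subgroup of `Aut_F(P)`. -/
def IsFullyAutomized (p : ℕ) (P : Subgroup S) : Prop :=
  ∃ T : Sylow p (F.autF P), (T : Subgroup (F.autF P)) = (autS P).subgroupOf (F.autF P)

/-- For an isomorphism `e : Q → P`, the subgroup
`N_e = {g ∈ N_S(Q) | e ∘ c_g ∘ e⁻¹ ∈ Aut_S(P)}` of `S`. -/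
def extender {Q P : Subgroup S} (e : Q ≃* P) : Subgroup S :=
  ((autS P).comap ((MulAut.congr e).toMonoidHom.comp Q.normalizerMonoidHom)).map
    (Subgroup.subtype _)

/-- `P` is receptive: every `F`-isomorphism `e : Q → P` extends to a morphism `N_e → S` of `F`. -/
def IsReceptive (P : Subgroup S) : Prop :=
  ∀ (Q : Subgroup S) (e : Q ≃* P), F.IsIso e →
    ∃ φ ∈ F.HomS (extender e), ∀ (x : S) (hx : x ∈ Q) (hN : x ∈ extender e),
      φ ⟨x, hN⟩ = e ⟨x, hx⟩

/-- A fusion system is saturated if every subgroup is `F`-conjugate to a fully automized and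
receptive one. -/
def IsSaturated (p : ℕ) : Prop :=
  ∀ P : Subgroup S, ∃ Q, F.IsConj P Q ∧ F.IsFullyAutomized p Q ∧ F.IsReceptive Q

/-- The `F`-centric subgroups of `S`, i.e. the objects of `F^c`. -/
structure Centric where
  toSubgroup : Subgroup S
  isCentric : F.IsCentric toSubgroup

instance : CoeOut F.Centric (Subgroup S) := ⟨Centric.toSubgroup⟩

lemma isConj_refl (P : Subgroup S) : F.IsConj P P :=
  ⟨MulEquiv.refl P, F.id_mem P, F.id_mem P⟩

lemma IsConj.card_eq {F : FusionSystem S} {P Q : Subgroup S} (h : F.IsConj P Q) :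
    Nat.card P = Nat.card Q := Nat.card_congr h.choose.toEquiv

lemma IsCentric.isFullyCentralized {F : FusionSystem S} {P : Subgroup S} (h : F.IsCentric P) :
    F.IsFullyCentralized P := by
  intro Q hQ
  rw [h Q hQ, h P (F.isConj_refl P)]
  obtain ⟨e, -⟩ := hQ
  have key : ∀ R : Subgroup S, Nat.card ((Subgroup.center R).map R.subtype) =
      Nat.card (Subgroup.center R) := fun R =>
    (Nat.card_congr ((Subgroup.center R).equivMapOfInjective _ R.subtype_injective).toEquiv).symm
  rw [key, key, Nat.card_congr (Subgroup.centerCongr e).toEquiv]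

lemma isCentric_top [Finite S] : F.IsCentric (⊤ : Subgroup S) := by
  intro Q hQ
  obtain rfl : Q = ⊤ := Subgroup.eq_top_of_card_eq Q (by
    rw [← hQ.card_eq, Subgroup.card_top])
  ext x
  simp only [Subgroup.mem_centralizer_iff, Subgroup.mem_map, Subgroup.mem_center_iff]
  constructor
  · intro h
    exact ⟨⟨x, trivial⟩, fun g => Subtype.ext (h g trivial), rfl⟩
  · rintro ⟨y, hy, rfl⟩ g -
    exact congrArg Subtype.val (hy ⟨g, trivial⟩)

/-- The group `S` as an object of `F^c`. -/
def Centric.top [Finite S] : F.Centric := ⟨⊤, F.isCentric_top⟩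

end FusionSystem

/-! ### Centric linking systems -/

/-- The transporter set `T_S(P, Q) = {g ∈ S | g P g⁻¹ ≤ Q}`. -/
def Transporter (P Q : Subgroup S) : Type u := {g : S // ∀ x ∈ P, g * x * g⁻¹ ∈ Q}

namespace Transporter

/-- An element of `Q`, seen in `T_S(Q, Q)`. -/
def ofMem {Q : Subgroup S} (g : S) (hg : g ∈ Q) : Transporter Q Q :=
  ⟨g, fun _ hx => Q.mul_mem (Q.mul_mem hg hx) (Q.inv_mem hg)⟩

/-- An element of `C_S(Q)`, seen in `T_S(Q, Q)`. -/
def ofCentralizer {Q : Subgroup S} (g : S) (hg : g ∈ Subgroup.centralizer (Q : Set S)) :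
    Transporter Q Q :=
  ⟨g, fun x hx => by
    rw [← Subgroup.mem_centralizer_iff.1 hg x hx, mul_inv_cancel_right]; exact hx⟩

/-- The unit element in `T_S(P, Q)`, for `P ≤ Q`. -/
def one {P Q : Subgroup S} (h : P ≤ Q) : Transporter P Q := ⟨1, fun x hx => by simpa using h hx⟩

/-- The product of transporter elements; this is the composition of the transporter category. -/
def mul {P Q R : Subgroup S} (h : Transporter Q R) (g : Transporter P Q) : Transporter P R :=
  ⟨h.1 * g.1, fun x hx => by simpa [mul_assoc] using h.2 _ (g.2 x hx)⟩

end Transporter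

/-- A centric linking system associated to the fusion system `F`: a finite category with the
`F`-centric subgroups as objects, with functors `δ` from the transporter category and `π` to `F`
(both the identity on objects), subject to the usual axioms. -/
structure CentricLinkingSystem (F : FusionSystem S) where
  category : SmallCategory F.Centric
  finite_hom (P Q : F.Centric) : Finite (P ⟶ Q)
  δ {P Q : F.Centric} : Transporter (P : Subgroup S) Q → (P ⟶ Q)
  δ_one (P : F.Centric) : δ (Transporter.one le_rfl) = 𝟙 P
  δ_mul {P Q R : F.Centric} (h : Transporter (Q : Subgroup S) R)
    (g : Transporter (P : Subgroup S) Q) : δ (h.mul g) = δ g ≫ δ h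
  π {P Q : F.Centric} : (P ⟶ Q) → ((P : Subgroup S) →* (Q : Subgroup S))
  π_mem {P Q : F.Centric} (φ : P ⟶ Q) : π φ ∈ F.Hom P Q
  π_id (P : F.Centric) : π (𝟙 P) = MonoidHom.id _
  π_comp {P Q R : F.Centric} (φ : P ⟶ Q) (ψ : Q ⟶ R) : π (φ ≫ ψ) = (π ψ).comp (π φ)
  /-- freeness of the action of `C_S(P)` on `Hom_L(P, Q)` by precomposition with `δ` -/
  free {P Q : F.Centric} (hP : F.IsFullyCentralized P) (φ : P ⟶ Q) (g : S)
    (hg : g ∈ Subgroup.centralizer ((P : Subgroup S) : Set S)) :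
    δ (Transporter.ofCentralizer g hg) ≫ φ = φ → g = 1
  /-- `π` is the orbit map of this action: it is onto `Hom_F(P, Q)` -/
  π_surjective {P Q : F.Centric} (hP : F.IsFullyCentralized P)
    (φ : (P : Subgroup S) →* (Q : Subgroup S)) (hφ : φ ∈ F.Hom P Q) : ∃ ψ : P ⟶ Q, π ψ = φ
  /-- `π` is the orbit map of this action: its fibres are the orbits -/
  π_eq_iff {P Q : F.Centric} (hP : F.IsFullyCentralized P) (φ ψ : P ⟶ Q) :
    π φ = π ψ ↔ ∃ (g : S) (hg : g ∈ Subgroup.centralizer ((P : Subgroup S) : Set S)),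
      ψ = δ (Transporter.ofCentralizer g hg) ≫ φ
  /-- `π(δ(g)) = c_g` -/
  π_δ {P Q : F.Centric} (g : Transporter (P : Subgroup S) Q) : π (δ g) = conjHom g.1 P Q g.2
  /-- `ψ ∘ δ(g) = δ(π(ψ)(g)) ∘ ψ` -/
  comm {P Q : F.Centric} (ψ : P ⟶ Q) (g : (P : Subgroup S)) :
    δ (Transporter.ofMem g.1 g.2) ≫ ψ = ψ ≫ δ (Transporter.ofMem (π ψ g).1 (π ψ g).2)

namespace CentricLinkingSystem

variable {F : FusionSystem S}

/-- The category underlying a centric linking system. -/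
def Obj (_L : CentricLinkingSystem F) : Type u := F.Centric

instance (L : CentricLinkingSystem F) : SmallCategory L.Obj := L.category

variable [Finite S] (L : CentricLinkingSystem F)

/-- The object `S`. -/
def top : L.Obj := FusionSystem.Centric.top F

/-- The fundamental group `π_L = π₁(|L|, S)`. Products are read as compositions: `a * b` is the
loop `b` followed by the loop `a`. -/
abbrev piOne : Type u := FundamentalGroup (NerveRealization.Realization L.Obj)
  (NerveRealization.vertex L.top)

/-- The morphism `ι_P = δ(1) : P ⟶ S`. -/
def ι (P : L.Obj) : P ⟶ L.top := L.δ (Transporter.one le_top)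

/-- `ω(φ)`, the class of the loop `ι_Q . φ . ι_P⁻¹` (first `ι_P` backwards, then `φ`,
then `ι_Q`). -/
def omega {P Q : L.Obj} (φ : P ⟶ Q) : L.piOne :=
  Groupoid.inv (NerveRealization.edge (L.ι P)) ≫ NerveRealization.edge φ ≫
    NerveRealization.edge (L.ι Q)

lemma omega_id (P : L.Obj) : L.omega (𝟙 P) = 1 := by
  simp [omega, NerveRealization.edge_id, End.one_def]

lemma omega_comp {P Q R : L.Obj} (φ : P ⟶ Q) (ψ : Q ⟶ R) :
    L.omega (φ ≫ ψ) = L.omega ψ * L.omega φ := by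
  simp [omega, NerveRealization.edge_comp, End.mul_def]

lemma ι_top : L.ι L.top = 𝟙 L.top := L.δ_one _

lemma omega_ι (P : L.Obj) : L.omega (L.ι P) = 1 := by
  simp [omega, ι_top, NerveRealization.edge_id, End.one_def]

/-- The homomorphism `S → π_L` induced by `δ_S` and `ω`. -/
def toPiOne : S →* L.piOne where
  toFun s := L.omega (P := L.top) (Q := L.top)
    (L.δ (Transporter.ofMem (Q := ⊤) s (Subgroup.mem_top s)))
  map_one' := (congrArg L.omega (L.δ_one _)).trans (L.omega_id L.top)
  map_mul' s t := (congrArg L.omega (L.δ_mul (P := FusionSystem.Centric.top F)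
    (Q := FusionSystem.Centric.top F) (R := FusionSystem.Centric.top F)
    (Transporter.ofMem (Q := ⊤) s (Subgroup.mem_top s))
    (Transporter.ofMem (Q := ⊤) t (Subgroup.mem_top t)))).trans (L.omega_comp _ _)

lemma omega_δ (P : L.Obj) (g : S) (hg : g ∈ FusionSystem.Centric.toSubgroup P) :
    L.omega (P := P) (Q := P) (L.δ (Transporter.ofMem g hg)) = L.toPiOne g := by
  have h : CategoryStruct.comp (obj := L.Obj) (X := P) (Y := P) (Z := L.top)
        (L.δ (Transporter.ofMem g hg)) (L.ι P) =
      CategoryStruct.comp (obj := L.Obj) (X := P) (Y := L.top) (Z := L.top) (L.ι P)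
        (L.δ (Transporter.ofMem (Q := ⊤) g (Subgroup.mem_top g))) := by
    refine (L.δ_mul _ _).symm.trans (Eq.trans ?_ (L.δ_mul _ _))
    congr 1
    apply Subtype.ext
    exact (one_mul g).trans (mul_one g).symm
  have := (L.omega_comp _ _).symm.trans ((congrArg L.omega h).trans (L.omega_comp _ _))
  rw [omega_ι, one_mul, mul_one] at this
  exact this

/-! ### The cohomology functor with twisted coefficients -/

variable {k : Type u} [CommRing k] (M : Rep.{u} k L.piOne)

/-- A `k[π_L]`-module as a `k[S]`-module. -/
abbrev resS : Rep.{u} k S := Rep.res L.toPiOne M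

/-- The cohomology `H^n(S, M)`. -/
abbrev HS (n : ℕ) : ModuleCat k := groupCohomology (L.resS M) n

/-- The cohomology `H^n(P, M)` of a subgroup `P ≤ S`. -/
abbrev H (P : Subgroup S) (n : ℕ) : ModuleCat k :=
  groupCohomology (Rep.res P.subtype (L.resS M)) n

/-- The restriction `H^n(S, M) ⟶ H^n(P, M)`. -/
def resMap (P : Subgroup S) (n : ℕ) : L.HS M n ⟶ L.H M P n :=
  groupCohomology.map P.subtype (𝟙 _) n

/-- The transfer `H^n(P, M) ⟶ H^n(S, M)`. -/
def trMap (P : Subgroup S) (n : ℕ) : L.H M P n ⟶ L.HS M n := GroupTransfer.transfer P (L.resS M) n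

/-- For `ψ : Q ⟶ Q'` in `L` and subgroups `P₀ ≤ Q`, `P₁ ≤ Q'` with `π(ψ)(P₀) ≤ P₁`, the morphism
`H^n(π(ψ)|, ω(ψ)⁻¹) : H^n(P₁, M) ⟶ H^n(P₀, M)` induced by the restriction `f : P₀ → P₁` of `π(ψ)`
and by the action of `ω(ψ)⁻¹` on `M`. -/
def pullRestrict {Q Q' : L.Obj} (ψ : Q ⟶ Q') {P₀ P₁ : Subgroup S} (h₀ : P₀ ≤ Q.toSubgroup)
    (f : P₀ →* P₁) (hf : ∀ x : P₀, (f x : S) = L.π ψ (Subgroup.inclusion h₀ x)) (n : ℕ) :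
    L.H M P₁ n ⟶ L.H M P₀ n :=
  groupCohomology.map f (Rep.ofHom ⟨M.ρ (L.omega ψ)⁻¹, fun g => by
    change M.ρ (L.omega ψ)⁻¹ * M.ρ (L.toPiOne (f g)) = M.ρ (L.toPiOne g) * M.ρ (L.omega ψ)⁻¹
    rw [← map_mul, ← map_mul]
    congr 1
    have h := congrArg L.omega (L.comm ψ (Subgroup.inclusion h₀ g))
    rw [inv_mul_eq_iff_eq_mul, ← mul_assoc, eq_mul_inv_iff_mul_eq, hf,
      ← L.omega_δ Q g (h₀ g.2), ← L.omega_δ Q' _ (L.π ψ (Subgroup.inclusion h₀ g)).2]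
    exact (L.omega_comp _ _).symm.trans (h.symm.trans (L.omega_comp _ _))⟩) n

/-- `H^n(ψ, M) = H^n(π(ψ), ω(ψ)⁻¹) : H^n(Q, M) ⟶ H^n(P, M)`, for `ψ : P ⟶ Q` in `L`. -/
def pull {P Q : L.Obj} (ψ : P ⟶ Q) (n : ℕ) : L.H M Q.toSubgroup n ⟶ L.H M P.toSubgroup n :=
  L.pullRestrict M ψ le_rfl (L.π ψ) (fun _ => rfl) n

/-- A morphism `ψ` of `L` with `π(ψ) = φ`. -/
def lift {P Q : L.Obj} (φ : P.toSubgroup →* Q.toSubgroup)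
    (hφ : φ ∈ F.Hom P.toSubgroup Q.toSubgroup) : P ⟶ Q :=
  (L.π_surjective P.isCentric.isFullyCentralized φ hφ).choose

/-- `φ^* : H^n(Q, M) ⟶ H^n(P, M)` for `φ ∈ Hom_F(P, Q)` with `P`, `Q` both `F`-centric: it is
`H^n(ψ, M)` for a morphism `ψ` of `L` with `π(ψ) = φ`. -/
def pullF {P Q : L.Obj} (φ : P.toSubgroup →* Q.toSubgroup)
    (hφ : φ ∈ F.Hom P.toSubgroup Q.toSubgroup) (n : ℕ) :
    L.H M Q.toSubgroup n ⟶ L.H M P.toSubgroup n :=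
  L.pull M (L.lift φ hφ) n

/-- The submodule `H^n(F^c, M)` of `F^c`-stable elements of `H^n(S, M)`: those `x` such that
`φ^*(x) = Res_P^S(x)` for all `F`-centric `P` and all `φ ∈ Hom_F(P, S)`. (The group `S` and its
subgroup `⊤` are identified by means of the restriction from `S` to `⊤`.) -/
def stable (n : ℕ) : Submodule k (L.HS M n) where
  carrier := {x | ∀ (P : L.Obj) (φ : P.toSubgroup →* L.top.toSubgroup)
    (hφ : φ ∈ F.Hom P.toSubgroup L.top.toSubgroup),
    L.pullF M φ hφ n (L.resMap M L.top.toSubgroup n x) = L.resMap M P.toSubgroup n x}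
  add_mem' ha hb P φ hφ := by
    rw [map_add, map_add, map_add, ha P φ hφ, hb P φ hφ]
  zero_mem' P φ hφ := by rw [map_zero, map_zero, map_zero]
  smul_mem' c x hx P φ hφ := by rw [map_smul, map_smul, map_smul, hx P φ hφ]

/-! ### Bisets and their endomorphisms -/

/-- The restriction `R → π(ψ)(R)` of `π(ψ)`, for `ψ : Q ⟶ Q'` in `L` and `R ≤ Q`, as a
homomorphism to `S`. -/
def restrictHom {Q Q' : L.Obj} (ψ : Q ⟶ Q') {R : Subgroup S} (hR : R ≤ Q.toSubgroup) : R →* S :=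
  Q'.toSubgroup.subtype.comp ((L.π ψ).comp (Subgroup.inclusion hR))

/-- `L.Decomposition M P R φ Φ` says that there are `ψ_i ∈ Aut_L(Q_i)` (`1 ≤ i ≤ r`) and
`P = P_0, …, P_r = R` with `P_{i-1} ≤ Q_i` and `P_i = π(ψ_i)(P_{i-1})` such that `φ : P → R` is the
composite `π(ψ_r)| ∘ ⋯ ∘ π(ψ_1)|` and `Φ : H^*(R, M) → H^*(P, M)` is the composite
`H^*(π(ψ_1)|, ω(ψ_1)⁻¹) ∘ ⋯ ∘ H^*(π(ψ_r)|, ω(ψ_r)⁻¹)`. -/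
inductive Decomposition (P : Subgroup S) :
    (R : Subgroup S) → (P →* R) → (∀ n : ℕ, L.H M R n ⟶ L.H M P n) → Prop
  | nil : Decomposition P P (MonoidHom.id P) fun _ => 𝟙 _
  | cons {R : Subgroup S} {φ : P →* R} {Φ : ∀ n : ℕ, L.H M R n ⟶ L.H M P n}
      (h : Decomposition P R φ Φ) (Q : L.Obj) (ψ : Q ≅ Q) (hR : R ≤ Q.toSubgroup) :
      Decomposition P (L.restrictHom ψ.hom hR).range
        ((L.restrictHom ψ.hom hR).rangeRestrict.comp φ)
        fun n => L.pullRestrict M ψ.hom hR (L.restrictHom ψ.hom hR).rangeRestrict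
          (fun _ => rfl) n ≫ Φ n

/-- `Λ` is a `[P, φ]`-endomorphism of `H^*(S, M)`: a composite `tr_P^S ∘ Φ ∘ Res^S_{φ(P)}`, with `Φ`
given by a decomposition of `φ` into restrictions of automorphisms of `F`-centric subgroups. -/
def IsPairEndomorphism (P : Subgroup S) (φ : P →* S) (Λ : ∀ n : ℕ, Module.End k (L.HS M n)) :
    Prop :=
  ∃ (R : Subgroup S) (φ' : P →* R) (Φ : ∀ n : ℕ, L.H M R n ⟶ L.H M P n),
    L.Decomposition M P R φ' Φ ∧ φ = R.subtype.comp φ' ∧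
      ∀ n, Λ n = (L.resMap M R n ≫ Φ n ≫ L.trMap M P n).hom

end CentricLinkingSystem

section Biset

open MulOpposite

/-- The subgroup `Δ(P, φ) = {(x, φ(x)) | x ∈ P}` of `S × S`. -/
def graphSubgroup (P : Subgroup S) (φ : P →* S) : Subgroup (S × S) := (P.subtype.prod φ).range

/-- The transitive `(S, S)`-biset `[P, φ] = (S × S)/Δ(P, φ)`. -/
def TransitiveBiset (P : Subgroup S) (φ : P →* S) : Type u := (S × S) ⧸ graphSubgroup P φ

namespace TransitiveBiset

variable (P : Subgroup S) (φ : P →* S)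

instance : MulAction (S × S) (TransitiveBiset P φ) :=
  inferInstanceAs (MulAction (S × S) ((S × S) ⧸ graphSubgroup P φ))

/-- The left action `s · (a, b)Δ = (s a, b)Δ`. -/
instance : MulAction S (TransitiveBiset P φ) :=
  MulAction.compHom _ (MonoidHom.inl S S)

/-- The right action `(a, b)Δ · t = (a, t⁻¹ b)Δ`. -/
instance : MulAction Sᵐᵒᵖ (TransitiveBiset P φ) :=
  MulAction.compHom _ ((MonoidHom.inr S S).comp (MulEquiv.inv' S).symm.toMonoidHom)

end TransitiveBiset

/-- Two `(S, S)`-bisets are isomorphic. -/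
def BisetIso (S : Type u) [Group S] (X Y : Type*) [MulAction S X] [MulAction Sᵐᵒᵖ X]
    [MulAction S Y] [MulAction Sᵐᵒᵖ Y] : Prop :=
  ∃ e : X ≃ Y, (∀ (s : S) (x : X), e (s • x) = s • e x) ∧
    ∀ (t : S) (x : X), e (op t • x) = op t • e x

variable (F : FusionSystem S) (Ω : Type*) [MulAction S Ω] [MulAction Sᵐᵒᵖ Ω]

/-- `Ω` is isomorphic to the disjoint union of the `[P_i, φ_i]`, with all `φ_i ∈ Hom_F(P_i, S)`. -/
def FusionSystem.IsBisetDecomposition {m : ℕ} (P : Fin m → Subgroup S) (φ : ∀ i, P i →* S) :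
    Prop :=
  (∀ i, φ i ∈ F.HomS (P i)) ∧ BisetIso S Ω (Σ i, TransitiveBiset (P i) (φ i))

/-- `Ω` is an `F`-characteristic `(S, S)`-biset: left-free, `F`-generated, left-`F`-stable,
right-`F`-stable and non-degenerate. -/
structure FusionSystem.IsCharacteristic (p : ℕ) : Prop where
  left_free (s : S) (x : Ω) : s • x = x → s = 1
  generated : ∃ (m : ℕ) (P : Fin m → Subgroup S) (φ : ∀ i, P i →* S),
    F.IsBisetDecomposition Ω P φ
  /-- `_φΩ_S ≅ _PΩ_S` for `φ ∈ Hom_F(P, S)` -/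
  left_stable (P : Subgroup S) (φ : P →* S) : φ ∈ F.HomS P →
    ∃ e : Ω ≃ Ω, (∀ (x : P) (a : Ω), e (φ x • a) = (x : S) • e a) ∧
      ∀ (t : S) (a : Ω), e (op t • a) = op t • e a
  /-- `_SΩ_φ ≅ _SΩ_P` for `φ ∈ Hom_F(P, S)` -/
  right_stable (P : Subgroup S) (φ : P →* S) : φ ∈ F.HomS P →
    ∃ e : Ω ≃ Ω, (∀ (s : S) (a : Ω), e (s • a) = s • e a) ∧
      ∀ (x : P) (a : Ω), e (op (φ x) • a) = op (x : S) • e a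
  nondegenerate : ¬ p ∣ Nat.card Ω / Nat.card S

/-- `ω` is an `Ω`-endomorphism of `H^*(S, M)`: a sum, over the transitive components `[P_i, φ_i]`
of `Ω`, of `[P_i, φ_i]`-endomorphisms. -/
def CentricLinkingSystem.IsBisetEndomorphism {F : FusionSystem S} [Finite S]
    (L : CentricLinkingSystem F) {k : Type u} [CommRing k] (M : Rep.{u} k L.piOne)
    (ω : ∀ n : ℕ, Module.End k (L.HS M n)) : Prop :=
  ∃ (m : ℕ) (P : Fin m → Subgroup S) (φ : ∀ i, P i →* S), F.IsBisetDecomposition Ω P φ ∧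
    ∃ Λ : Fin m → ∀ n : ℕ, Module.End k (L.HS M n),
      (∀ i, L.IsPairEndomorphism M (P i) (φ i) (Λ i)) ∧ ∀ n, ω n = ∑ i, Λ i n

instance isPrime_span_natCast (p : ℕ) [hp : Fact p.Prime] : (Ideal.span {(p : ℤ)}).IsPrime :=
  (Ideal.span_singleton_prime (by exact_mod_cast hp.out.ne_zero)).2
    (Nat.prime_iff_prime_int.1 hp.out)

/-- The element `|S|/|Ω| = (|Ω|/|S|)⁻¹` of `ℤ_(p)`, for an `F`-characteristic biset `Ω`. -/
def FusionSystem.IsCharacteristic.ratio {F : FusionSystem S} {Ω : Type*} [MulAction S Ω]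
    [MulAction Sᵐᵒᵖ Ω] {p : ℕ} [Fact p.Prime] (h : F.IsCharacteristic Ω p) (k : Type*) [CommRing k]
    [IsLocalization.AtPrime k (Ideal.span {(p : ℤ)})] : k :=
  IsLocalization.mk' k (1 : ℤ)
    (⟨((Nat.card Ω / Nat.card S : ℕ) : ℤ), fun hm => h.nondegenerate
      (Int.natCast_dvd_natCast.1 (Ideal.mem_span_singleton.1 hm))⟩ :
      (Ideal.span {(p : ℤ)}).primeCompl)

end Biset

end

end

/-! A stable class is an eigenvector of every `[P, φ]`-endomorphism, with eigenvalue the index `[S :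
P]`. Write the endomorphism as a transfer after pullbacks along restricted automorphisms of centric
subgroups after a restriction to `φ(P)`. If `x` is stable, each pullback carries the restriction of
`x` to `P_i` to its restriction to `P_{i-1}` (`Decomposition.apply_resMap`). Hence only `tr ∘ Res`
on `P` remains, and this is multiplication by `[S : P]` (`GroupTransfer.restriction_transfer`).
Since `[P, φ]` has `[S : P] · |S|` elements, summing over the components of `Ω` gives the factor
`|Ω|/|S|` (`card_div_card`). This is prime to `p`, so it is invertible in the coefficient ring and
`ratio` cancels it.

Two points need care. Stability is stated through one chosen lift of each `φ` to the linking system,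
whereas a decomposition may use any lift. Two lifts differ by an element of `C_S(P) = Z(P)`, and
central elements act trivially on cohomology (`map_centralEnd`), so the choice does not matter
(`pull_eq_of_π_eq`). Moreover the subgroups `P_i` need not be centric. Stability is therefore used
at the centric overgroup `Q_i`, and the resulting equality is restricted (`resMap_pullRestrict`). -/

noncomputable section

/-! ### Central elements act trivially on group cohomology. -/

namespace GroupCohomologyCentral
open Rep groupCohomology

variable {k G : Type u} [CommRing k] [Group G]

/-- The action of a central element, as an endomorphism of a representation. -/
def centralEnd (A : Rep.{u} k G) (z : G) (hz : z ∈ Subgroup.center G) : A ⟶ A :=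
  Rep.ofHom ⟨A.ρ z, fun g => by
    change A.ρ z * A.ρ g = A.ρ g * A.ρ z
    rw [← map_mul, ← map_mul, Subgroup.mem_center_iff.1 hz g]⟩

lemma centralEnd_naturality {A B : Rep.{u} k G} (f : A ⟶ B) (z : G)
    (hz : z ∈ Subgroup.center G) :
    centralEnd A z hz ≫ f = f ≫ centralEnd B z hz := by
  ext x
  exact hom_comm_apply f z x

/-- The action of a central element on the bar resolution. -/
def centralBar (z : G) (hz : z ∈ Subgroup.center G) : barComplex k G ⟶ barComplex k G where
  f _ := centralEnd _ z hz
  comm' _ _ _ := centralEnd_naturality _ z hz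

/-- The action of a central element on the bar resolution is homotopic to the identity. -/
def centralBarHomotopy (z : G) (hz : z ∈ Subgroup.center G) :
    Homotopy (centralBar (k := k) z hz) (𝟙 (barComplex k G)) :=
  ProjectiveResolution.liftHomotopy (P := barResolution k G) (Q := barResolution k G) (𝟙 _) _ _
    (by
      rw [CategoryTheory.Functor.map_id, Category.comp_id]
      apply HomologicalComplex.to_single_hom_ext
      -- Moved past the augmentation, `z` acts on the trivial module, hence as the identity. Both
      -- chain maps thus lift the same map, and lifts to a projective resolution are unique up to
      -- homotopy.
      refine (centralEnd_naturality ((barResolution k G).π.f 0) z hz).trans ?_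
      refine Eq.trans ?_ (Category.comp_id _)
      congr 1)
    (by
      rw [CategoryTheory.Functor.map_id, Category.comp_id]
      exact Category.id_comp _)

/-- Precomposition with an endomorphism of the bar resolution. -/
def precompBar (A : Rep.{u} k G) (c : barComplex k G ⟶ barComplex k G) :
    (barComplex k G).linearYonedaObj k A ⟶ (barComplex k G).linearYonedaObj k A :=
  (HomologicalComplex.unopFunctor _ _).map
    (((((linearYoneda k (Rep k G)).obj A).rightOp.mapHomologicalComplex _).map c).op)

/-- A cochain is an equivariant map out of the bar resolution, so applying `z` to its values is the
same as applying `z` to its arguments. This moves the action from the coefficients, where no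
homotopy is visible, to the resolution, where there is one. -/
lemma cochainsMap_centralEnd (A : Rep.{u} k G) (z : G) (hz : z ∈ Subgroup.center G) :
    cochainsMap (MonoidHom.id G) (centralEnd A z hz) =
      (inhomogeneousCochainsIso A).hom ≫ precompBar A (centralBar z hz) ≫
        (inhomogeneousCochainsIso A).inv := by
  refine HomologicalComplex.hom_ext _ _ fun n => ModuleCat.hom_ext (LinearMap.ext fun f =>
    funext fun x => ?_)
  change A.ρ z (f x) = (freeLift k G A f).hom
    ((free k G (Fin n → G)).ρ z (Finsupp.single x (.single 1 1)))
  rw [hom_comm_apply, Rep.hom_ofHom, Representation.freeLift_single_single, map_one, one_smul]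
  rfl

/-- A central element acts trivially on group cohomology. -/
lemma map_centralEnd (A : Rep.{u} k G) (z : G) (hz : z ∈ Subgroup.center G) (n : ℕ) :
    groupCohomology.map (MonoidHom.id G) (centralEnd A z hz) n = 𝟙 _ := by
  -- The additive functor of equivariant maps into `A` preserves the homotopy on the bar resolution.
  have h : Homotopy (precompBar A (centralBar z hz)) (precompBar A (𝟙 _)) :=
    ((((linearYoneda k (Rep k G)).obj A).rightOp.mapHomotopy (centralBarHomotopy z hz))).unop
  have h1 : precompBar A (𝟙 (barComplex k G)) = 𝟙 _ := by
    unfold precompBar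
    rw [CategoryTheory.Functor.map_id, op_id, CategoryTheory.Functor.map_id]
    rfl
  rw [h1] at h
  have h2 := ((h.compLeft (inhomogeneousCochainsIso A).hom).compRight
    (inhomogeneousCochainsIso A).inv).homologyMap_eq n
  rw [Category.comp_id, Iso.hom_inv_id, HomologicalComplex.homologyMap_id, Category.assoc,
    ← cochainsMap_centralEnd] at h2
  exact h2

end GroupCohomologyCentral

/-! ### Transfer after restriction. -/

namespace GroupTransfer
open Rep groupCohomology

variable {k G : Type u} [CommRing k] [Group G] (P : Subgroup G) (M : Rep.{u} k G)

/-- The unit `m ↦ (h ↦ h m)` of the adjunction between restriction and coinduction. -/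
def coindUnit : M ⟶ coind P.subtype (res P.subtype M) :=
  Rep.ofHom ⟨LinearMap.codRestrict _ (LinearMap.pi fun h => M.ρ h) fun m g h => by
      change M.ρ ((g : G) * h) m = M.ρ (g : G) (M.ρ h m)
      rw [map_mul, Module.End.mul_apply], fun g => by
    ext m h
    change M.ρ h (M.ρ g m) = M.ρ (h * g) m
    rw [map_mul, Module.End.mul_apply]⟩

/-- The unit followed by evaluation at `1` is the identity of `M`. Restriction therefore factors
through the Shapiro map, whose inverse is the first half of the transfer. -/
lemma coindUnit_shapiro (n : ℕ) :
    groupCohomology.map (MonoidHom.id G) (coindUnit P M) n ≫ shapiro P (res P.subtype M) n =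
      groupCohomology.map P.subtype (𝟙 (res P.subtype M)) n := by
  refine (groupCohomology.map_comp (MonoidHom.id G) P.subtype (coindUnit P M) _ n).symm.trans ?_
  refine groupCohomology.map_congr rfl ?_ n
  ext m
  change M.ρ 1 m = m
  rw [map_one, Module.End.one_apply]

/-- Every coset `gP` contributes `g (g⁻¹ m) = m`, so the norm merely counts cosets. -/
lemma coindUnit_normMap_apply [Finite G] (m : M) :
    (normMap P M).hom ((coindUnit P M).hom m) = P.index • m := by
  let _ := Fintype.ofFinite (G ⧸ P)
  change (∑ q : G ⧸ P, normTermQuot P M q) ((coindUnit P M).hom m) = _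
  rw [LinearMap.sum_apply]
  have : ∀ q : G ⧸ P, normTermQuot P M q ((coindUnit P M).hom m) = m := fun q => by
    induction q using QuotientGroup.induction_on with | H g => ?_
    change M.ρ g (M.ρ g⁻¹ m) = m
    rw [← Module.End.mul_apply, ← map_mul, mul_inv_cancel, map_one, Module.End.one_apply]
  rw [Finset.sum_congr rfl fun q _ => this q, Finset.sum_const, Finset.card_univ,
    Subgroup.index, Nat.card_eq_fintype_card]

lemma cochainsMap_nsmul_id (j : ℕ) {φ : M ⟶ M} (hφ : ∀ m, φ.hom m = j • m) :
    cochainsMap (MonoidHom.id G) φ = j • 𝟙 (inhomogeneousCochains M) := by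
  refine HomologicalComplex.hom_ext _ _ fun n => ModuleCat.hom_ext (LinearMap.ext fun f =>
    funext fun x => ?_)
  rw [HomologicalComplex.nsmul_f_apply, ModuleCat.hom_nsmul]
  exact hφ (f x)

/-- Restriction to a subgroup followed by the transfer is multiplication by the index. -/
lemma restriction_transfer [Finite G] (n : ℕ) :
    groupCohomology.map P.subtype (𝟙 (res P.subtype M)) n ≫ transfer P M n =
      P.index • 𝟙 (groupCohomology M n) := by
  -- The Shapiro map cancels against its inverse. What is left is induced by the unit followed by
  -- the norm, which is multiplication by the index already on cochains.
  rw [← coindUnit_shapiro, transfer, Category.assoc, IsIso.hom_inv_id_assoc,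
    ← groupCohomology.map_id_comp, groupCohomology.map,
    cochainsMap_nsmul_id M P.index (coindUnit_normMap_apply P M)]
  exact ((HomologicalComplex.homologyFunctor (ModuleCat k) _ n).map_nsmul).trans
    (congrArg (P.index • ·) (HomologicalComplex.homologyMap_id _ n))

end GroupTransfer

/-! ### Independence of the lift, and pullbacks of stable elements. -/

namespace CentricLinkingSystem
open Rep

lemma π_lift {S : Type u} [Group S] {F : FusionSystem S} (L : CentricLinkingSystem F)
    {P Q : L.Obj} (φ : P.toSubgroup →* Q.toSubgroup)
    (hφ : φ ∈ F.Hom P.toSubgroup Q.toSubgroup) : L.π (L.lift φ hφ) = φ :=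
  (L.π_surjective P.isCentric.isFullyCentralized φ hφ).choose_spec

variable {S : Type u} [Group S] [Finite S] {F : FusionSystem S} (L : CentricLinkingSystem F)
  {k : Type u} [CommRing k] (M : Rep.{u} k L.piOne)

lemma π_ι (P : L.Obj) (x : P.toSubgroup) : (L.π (L.ι P) x : S) = x := by
  refine (congrArg Subtype.val (DFunLike.congr_fun (L.π_δ (Transporter.one le_top)) x)).trans ?_
  change (1 : S) * x * 1⁻¹ = x
  rw [one_mul, inv_one, mul_one]

/-- Automorphisms of `Q` occur in decompositions, but stability concerns morphisms to `S`. Composing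
with `ι` passes from one to the other without changing the action on `M`. -/
lemma omega_comp_ι {P Q : L.Obj} (ψ : P ⟶ Q) : L.omega (ψ ≫ L.ι Q) = L.omega ψ := by
  rw [omega_comp, omega_ι, one_mul]

lemma pull_comp {P Q R : L.Obj} (φ : P ⟶ Q) (ψ : Q ⟶ R) (n : ℕ) :
    L.pull M (φ ≫ ψ) n = L.pull M ψ n ≫ L.pull M φ n := by
  refine Eq.trans ?_ (groupCohomology.map_comp _ _ _ _ n)
  refine groupCohomology.map_congr (L.π_comp φ ψ) ?_ n
  ext m
  change M.ρ (L.omega (φ ≫ ψ))⁻¹ m = M.ρ (L.omega φ)⁻¹ (M.ρ (L.omega ψ)⁻¹ m)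
  rw [omega_comp, mul_inv_rev, map_mul, Module.End.mul_apply]

/-- Elements of the centralizer of a centric subgroup `P` act trivially on `H^n(P, M)`. -/
lemma pull_δ_centralizer (P : L.Obj) (g : S)
    (hg : g ∈ Subgroup.centralizer (P.toSubgroup : Set S)) (n : ℕ) :
    L.pull M (P := P) (Q := P) (L.δ (Transporter.ofCentralizer g hg)) n = 𝟙 _ := by
  have hg' := hg
  -- Centricity, applied to `P` itself, gives `C_S(P) = Z(P)`, so `g` is a central element `z` of
  -- `P`.
  rw [P.isCentric P.toSubgroup (F.isConj_refl _)] at hg'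
  obtain ⟨z, hz, rfl⟩ := hg'
  have hω : L.omega (P := P) (Q := P) (L.δ (Transporter.ofCentralizer (z : S) hg)) =
      L.toPiOne z := L.omega_δ P z z.2
  -- Conjugation by `z` is trivial on `P`, so only the coefficient part `ω(δ(z))⁻¹` survives. It is
  -- the action of `z⁻¹`, which explains the inverse.
  refine Eq.trans ?_ (GroupCohomologyCentral.map_centralEnd
    (Rep.res P.toSubgroup.subtype (L.resS M)) z⁻¹ (inv_mem hz) n)
  refine groupCohomology.map_congr ?_ ?_ n
  · refine (L.π_δ _).trans (MonoidHom.ext fun x => Subtype.ext ?_)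
    change (z : S) * x * (z : S)⁻¹ = x
    have h := congrArg Subtype.val (Subgroup.mem_center_iff.1 hz x)
    change (x : S) * z = z * x at h
    rw [← h, mul_inv_cancel_right]
  · ext m
    change M.ρ (L.omega _)⁻¹ m = M.ρ (L.toPiOne (z : S)⁻¹) m
    exact congrArg (fun w => M.ρ w m)
      ((congrArg (·⁻¹) hω).trans (map_inv L.toPiOne (z : S)).symm)

/-- `H^n(ψ, M)` only depends on `π(ψ)`. -/
lemma pull_eq_of_π_eq {P Q : L.Obj} {φ ψ : P ⟶ Q} (h : L.π φ = L.π ψ) (n : ℕ) :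
    L.pull M φ n = L.pull M ψ n := by
  obtain ⟨g, hg, rfl⟩ := (L.π_eq_iff P.isCentric.isFullyCentralized φ ψ).1 h
  refine Eq.trans ?_ (L.pull_comp M (L.δ (Transporter.ofCentralizer g hg)) φ n).symm
  rw [pull_δ_centralizer, Category.comp_id]

variable {M} {n : ℕ}

/-- Membership in `stable` tests only the lift picked by `lift`; independence of the lift extends it
to every `ψ`. -/
lemma pull_resMap_of_mem_stable {x : L.HS M n} (hx : x ∈ L.stable M n) {P : L.Obj}
    (ψ : P ⟶ L.top) :
    L.pull M ψ n (L.resMap M L.top.toSubgroup n x) = L.resMap M P.toSubgroup n x := by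
  rw [← hx P (L.π ψ) (L.π_mem ψ), pullF, L.pull_eq_of_π_eq M (L.π_lift _ (L.π_mem ψ))]

variable (M n) in
/-- The restriction `H^n(Q, M) ⟶ H^n(R, M)` for `R ≤ Q`. -/
def resLE {R Q : Subgroup S} (h : R ≤ Q) : L.H M Q n ⟶ L.H M R n :=
  groupCohomology.map (Subgroup.inclusion h) (𝟙 (Rep.res R.subtype (L.resS M))) n

variable (M n) in
lemma resMap_resLE {R Q : Subgroup S} (h : R ≤ Q) :
    L.resMap M Q n ≫ L.resLE M n h = L.resMap M R n := by
  refine (groupCohomology.map_comp _ _ _ _ n).symm.trans ?_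
  exact groupCohomology.map_congr rfl rfl n

variable (M n) in
-- Both sides come from the same pair: the homomorphism `R → S` given by `π(ψ)`, and the action of
-- `ω(ψ)⁻¹`. The right side passes through the object `Q`, so stability applies there although `R`
-- need not be centric.
lemma resMap_pullRestrict {Q Q' : L.Obj} (ψ : Q ⟶ Q') {R : Subgroup S}
    (hR : R ≤ Q.toSubgroup) :
    L.resMap M (L.restrictHom ψ hR).range n ≫
        L.pullRestrict M ψ hR (L.restrictHom ψ hR).rangeRestrict (fun _ => rfl) n =
      L.resMap M L.top.toSubgroup n ≫ L.pull M (ψ ≫ L.ι Q') n ≫ L.resLE M n hR := by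
  refine (groupCohomology.map_comp _ _ _ _ n).symm.trans (Eq.trans ?_
    ((groupCohomology.map_comp _ _ _ _ n).trans
      (congrArg (fun q => L.resMap M L.top.toSubgroup n ≫ q)
        (groupCohomology.map_comp _ _ _ _ n))))
  refine groupCohomology.map_congr (MonoidHom.ext fun x => ?_) ?_ n
  · exact (π_ι L Q' _).symm.trans (congrArg Subtype.val
      (DFunLike.congr_fun (L.π_comp ψ (L.ι Q')) (Subgroup.inclusion hR x))).symm
  · ext m
    change M.ρ (L.omega ψ)⁻¹ m = M.ρ (L.omega (ψ ≫ L.ι Q'))⁻¹ m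
    rw [omega_comp_ι]

lemma Decomposition.apply_resMap {x : L.HS M n} (hx : x ∈ L.stable M n) {P R : Subgroup S}
    {φ : P →* R} {Φ : ∀ n : ℕ, L.H M R n ⟶ L.H M P n} (h : L.Decomposition M P R φ Φ) :
    Φ n (L.resMap M R n x) = L.resMap M P n x := by
  induction h with
  | nil => rfl
  | @cons R φ Φ h Q ψ hR ih =>
    -- The newest automorphism acts first on cohomology. It suffices that it takes the restriction
    -- of `x` to `ψ(R)` to the restriction to `R`.
    refine Eq.trans ?_ ih
    change Φ n (_) = _
    congr 1
    refine (ConcreteCategory.congr_hom (L.resMap_pullRestrict M n ψ.hom hR) x).trans ?_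
    refine (congrArg (L.resLE M n hR)
      (L.pull_resMap_of_mem_stable hx (ψ.hom ≫ L.ι Q))).trans ?_
    exact ConcreteCategory.congr_hom (L.resMap_resLE M n hR) x

/-- The middle composite turns the restriction of `x` to `R` into its restriction to `P`, whatever
the chosen decomposition, and the transfer then produces the index. -/
lemma IsPairEndomorphism.apply_stable {x : L.HS M n} (hx : x ∈ L.stable M n) {P : Subgroup S}
    {φ : P →* S} {Λ : ∀ n : ℕ, Module.End k (L.HS M n)} (h : L.IsPairEndomorphism M P φ Λ) :
    Λ n x = P.index • x := by
  obtain ⟨R, φ', Φ, hd, -, hΛ⟩ := h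
  rw [hΛ]
  refine (congrArg (L.trMap M P n) (hd.apply_resMap L hx)).trans ?_
  exact ConcreteCategory.congr_hom (GroupTransfer.restriction_transfer P (L.resS M) n) x

end CentricLinkingSystem

/-! ### Counting bisets and summing over components. -/

section Biset

variable {S : Type u} [Group S] [Finite S]

instance (P : Subgroup S) (φ : P →* S) : Finite (TransitiveBiset P φ) :=
  inferInstanceAs (Finite ((S × S) ⧸ graphSubgroup P φ))

lemma TransitiveBiset.card_eq (P : Subgroup S) (φ : P →* S) :
    Nat.card (TransitiveBiset P φ) = P.index * Nat.card S := by
  -- The first projection recovers `x` from `(x, φ(x))`, so the graph has order `|P|`.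
  have h : Nat.card (graphSubgroup P φ) = Nat.card P :=
    (Nat.card_congr (MonoidHom.ofInjective (f := P.subtype.prod φ) fun x y hxy =>
      Subtype.ext (congrArg Prod.fst hxy)).toEquiv).symm
  have h1 := (graphSubgroup P φ).card_mul_index
  rw [h, Nat.card_prod, ← P.card_mul_index] at h1
  refine Nat.eq_of_mul_eq_mul_left (Nat.card_pos (α := P)) (h1.trans ?_)
  rw [← P.card_mul_index, mul_assoc]

/-- Each component has order a multiple of `|S|`, so the division of natural numbers is exact. -/
lemma FusionSystem.IsBisetDecomposition.card_div_card {F : FusionSystem S} {Ω : Type*}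
    [MulAction S Ω] [MulAction Sᵐᵒᵖ Ω] {m : ℕ} {P : Fin m → Subgroup S} {φ : ∀ i, P i →* S}
    (h : F.IsBisetDecomposition Ω P φ) :
    Nat.card Ω / Nat.card S = ∑ i, (P i).index := by
  obtain ⟨e, -⟩ := h.2
  rw [Nat.card_congr e, Nat.card_sigma, Finset.sum_congr rfl fun i _ =>
    TransitiveBiset.card_eq (P i) (φ i), ← Finset.sum_mul, Nat.mul_div_cancel _ Nat.card_pos]

lemma FusionSystem.IsCharacteristic.ratio_mul_natCast {S : Type u} [Group S]
    {F : FusionSystem S} {Ω : Type*} [MulAction S Ω] [MulAction Sᵐᵒᵖ Ω] {p : ℕ} [Fact p.Prime] (h : F.IsCharacteristic Ω p)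
    (k : Type*) [CommRing k] [IsLocalization.AtPrime k (Ideal.span {(p : ℤ)})] :
    h.ratio k * ((Nat.card Ω / Nat.card S : ℕ) : k) = 1 := by
  have h1 := IsLocalization.mk'_spec k (1 : ℤ)
    (⟨((Nat.card Ω / Nat.card S : ℕ) : ℤ), fun hm => h.nondegenerate
      (Int.natCast_dvd_natCast.1 (Ideal.mem_span_singleton.1 hm))⟩ :
      (Ideal.span {(p : ℤ)}).primeCompl)
  rw [map_one] at h1
  exact (congrArg (h.ratio k * ·) (map_natCast (algebraMap ℤ k) _).symm).trans h1

/-- An `Ω`-endomorphism multiplies stable elements by `|Ω|/|S|`. -/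
lemma CentricLinkingSystem.IsBisetEndomorphism.apply_stable {F : FusionSystem S}
    {L : CentricLinkingSystem F} {k : Type u} [CommRing k] {M : Rep.{u} k L.piOne} {Ω : Type*}
    [MulAction S Ω] [MulAction Sᵐᵒᵖ Ω] {ω : ∀ n : ℕ, Module.End k (L.HS M n)}
    (hω : L.IsBisetEndomorphism Ω M ω) {n : ℕ} {x : L.HS M n} (hx : x ∈ L.stable M n) :
    ω n x = (Nat.card Ω / Nat.card S) • x := by
  -- The decomposition comes with `ω` and need not be any previously fixed one. Only the sum of its
  -- indices matters, and this depends on `Ω` alone.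
  obtain ⟨m, P, φ, hd, Λ, hΛ, hsum⟩ := hω
  rw [hsum, LinearMap.sum_apply, hd.card_div_card, Finset.sum_smul]
  exact Finset.sum_congr rfl fun i _ => (hΛ i).apply_stable L hx

end Biset

end

theorem lemma4p7 {p : ℕ} [Fact p.Prime] {k : Type u} [CommRing k]
    [IsLocalization.AtPrime k (Ideal.span {(p : ℤ)})]
    {S : Type u} [Group S] [Finite S] (hS : IsPGroup p S)
    (F : FusionSystem S) (hF : F.IsSaturated p) (L : CentricLinkingSystem F)
    (M : Rep.{u} k L.piOne)
    (Ω : Type*) [MulAction S Ω] [MulAction Sᵐᵒᵖ Ω] [SMulCommClass S Sᵐᵒᵖ Ω]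
    (hΩ : F.IsCharacteristic Ω p)
    (ω : ∀ n : ℕ, Module.End k (L.HS M n)) (hω : L.IsBisetEndomorphism Ω M ω)
    (n : ℕ) (x : L.HS M n) (hx : x ∈ L.stable M n) :
    (hΩ.ratio k • ω n) x = x := by
  rw [LinearMap.smul_apply, hω.apply_stable hx, ← Nat.cast_smul_eq_nsmul k, smul_smul,
    hΩ.ratio_mul_natCast k, one_smul]
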